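/- **Setting.** Let $\mathcal N$ be a finite nonempty set of agents, $\mathcal E$ a nonempty set of nonempty subsets of $\mathcal N$ (edges), $X=[0,1]^{\mathcal E}$ the set of networks, $u_i:X\to\mathbb R$ ($i\in\mathcal N$) payoff functions, $\alpha\in[0,1]^{\mathcal E}$ capacities and $\beta\in(0,+\infty]^{\mathcal N}$ budgets. Let $\mathcal E^i$ be the set of edges containing $i$, $\mathcal E^C=\bigcup_{i\in C}\mathcal E^i$, and write $x=(x^i,x^{-i})=(x^C,x^{-C})$ for the corresponding splittings of a network. Put $$X^{\alpha,\beta}=\Big\{x\in\prod_{C\in\mathcal E}[0,\alpha_C]:\ \sum_{C\ni i}x_C\le\beta_i\ \text{ for all } i\in\mathcal N\Big\}.$$ The game $\Gamma=(\mathcal N,\mathcal E,u,\alpha,\beta)$ is *continuous* if every $u_i$ is continuous on $X$; *separable* if on $\prod_C[0,\alpha_C]$ one has $u_i(x)=\sum_{C\in\mathcal E}u_{i,C}(x_C)$ with functions $u_{i,C}:[0,\alpha_C]\to\mathbb R$; *concave* if every $u_i$ is concave in each single component $x_C\in[0,1]$; it has *positive externalities* if $u_i(x)\ge u_i(x^i,y^{-i})$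 for all $i$, all $x\in X^{\alpha,\beta}$ and all $y^{-i}\in[0,1]^{\mathcal E\setminus\mathcal E^i}$ with $y^{-i}\le x^{-i}$ componentwise; it is *bipartite* if $\mathcal N=U\sqcup V$ with every edge of the form $\{i,j\}$, $i\in U$, $j\in V$. A network $x$ is *fully stable* for $\Gamma$ if (1) $x\in X^{\alpha,\beta}$; (2) $u_i(y^i,x^{-i})\le u_i(x)$ for every agent $i$ and every $y^i\in[0,1]^{\mathcal E^i}$ with $y^i\le x^i$; (3) for every $C\in\mathcal E$ and every $y^C\in\prod_{C'\in\mathcal E^C}[0,\alpha_{C'}]$ such that $y^C_C\ge x_C$, $y^C_{C'}\le x_{C'}$ for all $C'\in\mathcal E^C\setminus\{C\}$ and $u_i(y^C,x^{-C})>u_i(x)$ for all $i\in C$, there is $j\in C$ with $\sum_{C'\in\mathcal E^j}y^C_{C'}>\beta_j$. *Generalized Deferred Acceptance* (GDA), for a game without externalities on a bipartite graph $\mathcal N=U\sqcup V$ (the payoff of $i$ being a function $u_i(y^i)$), keeps a network $x$ and capacities $a$, initially $x=0$ and $a=\alpha$. One step is as follows. Each $i\in U$ chooses $x'^i$ maximizing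 $u_i(y^i)$ over $y^i\in\prod_{C\ni i}[x_C,a_C]$ with $\sum_{C\ni i}y^i_C\le\beta_i$. Then each $j\in V$ chooses the new $x^j$ maximizing $u_j(y^j)$ over $y^j\in\prod_{C\ni j}[0,x'_C]$ with $\sum_{C\ni j}y^j_C\le\beta_j$. Then $a_C$ is replaced by $x_C$ for every edge $C$ with $x_C<x'_C$. Ties between maximizers are broken arbitrarily (for example by choosing the zero vector whenever it is a maximizer). The algorithm may terminate and return $x$ when no agent of $U$ can increase its payoff, i.e. when $x'=x$ is an admissible choice; otherwise it runs forever. **Statement.** Let $\Gamma=(\mathcal N,\mathcal E,u,\alpha,\beta)$ be a continuous, separable, concave and bipartite constrained network game with positive externalities. Then $\Gamma$ has a fully stable network. Moreover, for every bipartition $\mathcal N=U\sqcup V$ as above and every fixed $z\in\prod_C[0,\alpha_C]$, let $\Gamma'=(\mathcal N,\mathcal E,(u_i(\cdot,z^{-i}))_{i\in\mathcal N},\alpha,\beta)$ be the game in which the externality terms are frozen at $z$. Then: 1. every fully stable network of $\Gamma'$ is a fully stable network of $\Gamma$; 2. GDA on $\Gamma'$ never gets stuck: in every state reachable in finitely many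 steps the agents of $U$ have a maximizing choice, and the agents of $V$ have a maximizing answer to every such choice; both can be made so that the zero vector is chosen whenever it is a maximizer; 3. if GDA on $\Gamma'$ terminates, the returned network is fully stable for $\Gamma'$ and for $\Gamma$; 4. the networks of every infinite run of GDA on $\Gamma'$ converge to a network that is fully stable for $\Gamma'$ and for $\Gamma$. -/

import Mathlib

open Filter Topology

/-- A constrained network game on the finite set of agents `N` with set of edges (coalitions) `E`.
A network is a vector `x : E → ℝ`; the payoff functions only matter on `[0,1]^E`.
Budgets are positive, and the value `⊤` means that the agent has no budget constraint. -/
structure NetworkGame (N : Type*) (E : Finset (Finset N)) where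
  edges_nonempty : E.Nonempty
  coalition_nonempty : ∀ C ∈ E, C.Nonempty
  /-- payoff functions -/
  payoff : N → (E → ℝ) → ℝ
  /-- capacity vector -/
  capacity : E → ℝ
  capacity_mem : ∀ C, capacity C ∈ Set.Icc (0 : ℝ) 1
  /-- budget vector -/
  budget : N → EReal
  budget_pos : ∀ i, 0 < budget i

namespace NetworkGame

variable {N : Type*} [Fintype N] [DecidableEq N] {E : Finset (Finset N)}

/-- The set `X = [0,1]^E` of all networks. -/
def networks (E : Finset (Finset N)) : Set (E → ℝ) :=
  {x | ∀ C, x C ∈ Set.Icc (0 : ℝ) 1}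

/-- The network equal to `y` on the edges that meet the set of agents `S`
and equal to `w` on all other edges. -/
def splice (S : Finset N) (y w : E → ℝ) : E → ℝ :=
  fun C => if ∃ i ∈ S, i ∈ C.1 then y C else w C

/-- The total weight of the edges containing agent `i`. -/
def load (x : E → ℝ) (i : N) : ℝ := ∑ C : E with i ∈ C.1, x C

variable (G : NetworkGame N E)

/-- The box `∏ C, [0, α_C]`. -/
def capacityBox : Set (E → ℝ) := {x | ∀ C, x C ∈ Set.Icc 0 (G.capacity C)}

/-- The set of networks satisfying all capacity and budget constraints. -/
def feasible : Set (E → ℝ) :=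
  {x | x ∈ G.capacityBox ∧ ∀ i, (load x i : EReal) ≤ G.budget i}

/-- Fully stable networks. -/
def FullyStable (x : E → ℝ) : Prop :=
  x ∈ G.feasible ∧
  (∀ i : N, ∀ y ∈ networks E, (∀ C : E, i ∈ C.1 → y C ≤ x C) →
    G.payoff i (splice {i} y x) ≤ G.payoff i x) ∧
  (∀ C : E, ∀ y ∈ G.capacityBox,
    x C ≤ y C →
    (∀ C' : E, C' ≠ C → (∃ i ∈ C.1, i ∈ C'.1) → y C' ≤ x C') →
    (∀ i ∈ C.1, G.payoff i x < G.payoff i (splice C.1 y x)) →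
    ∃ j ∈ C.1, G.budget j < (load y j : EReal))

/-- Each payoff function is continuous on `[0,1]^E`. -/
def IsContinuous : Prop := ∀ i, ContinuousOn (G.payoff i) (networks E)

/-- The payoffs are sums of functions of one weight each (on the domain `∏ C, [0, α_C]`). -/
def IsSeparable : Prop :=
  ∃ f : E → N → ℝ → ℝ, ∀ x ∈ G.capacityBox, ∀ i, G.payoff i x = ∑ C : E, f C i (x C)

/-- Each payoff function is component-wise concave. -/
def IsConcave : Prop :=
  ∀ i, ∀ C : E, ∀ x ∈ networks E,
    ConcaveOn ℝ (Set.Icc (0 : ℝ) 1) (fun t => G.payoff i (Function.update x C t))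

/-- Lowering weights of edges not containing `i` never benefits `i`. -/
def HasPositiveExternalities : Prop :=
  ∀ i, ∀ x ∈ G.feasible, ∀ y ∈ networks E, (∀ C : E, i ∉ C.1 → y C ≤ x C) →
    G.payoff i (splice {i} x y) ≤ G.payoff i x

/-- `N = U ⊔ V` and every edge joins an agent of `U` to an agent of `V`. -/
def IsBipartition (E : Finset (Finset N)) (U V : Finset N) : Prop :=
  Disjoint U V ∧ U ∪ V = Finset.univ ∧ ∀ C ∈ E, ∃ i ∈ U, ∃ j ∈ V, C = {i, j}

/-- The game with the same edges and constraints in which agent `i` evaluates a network `y`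
by `u_i (y^i, z^{-i})`: the weights of the edges not containing `i` are frozen at `z`. -/
def freeze (z : E → ℝ) : NetworkGame N E where
  edges_nonempty := G.edges_nonempty
  coalition_nonempty := G.coalition_nonempty
  payoff i y := G.payoff i (splice {i} y z)
  capacity := G.capacity
  capacity_mem := G.capacity_mem
  budget := G.budget
  budget_pos := G.budget_pos

/-! ### Generalized Deferred Acceptance, for games without externalities -/

/-- Vectors of weights whose restriction to the edges of `i` lies between `l` and `h`
and respects the budget of `i`. -/
def ownFeasible (i : N) (l h : E → ℝ) : Set (E → ℝ) :=
  {y | (∀ C : E, i ∈ C.1 → l C ≤ y C ∧ y C ≤ h C) ∧ (load y i : EReal) ≤ G.budget i}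

/-- The restriction of `y` to the edges of `i` maximizes the payoff of `i` among all vectors on
these edges that lie between `l` and `h` and respect the budget of `i`. As the payoff of `i` is
meant not to depend on the other edges, these are given weight `0`. -/
def IsOwnArgmax (i : N) (l h y : E → ℝ) : Prop :=
  y ∈ G.ownFeasible i l h ∧
  ∀ w ∈ G.ownFeasible i l h, G.payoff i (splice {i} w 0) ≤ G.payoff i (splice {i} y 0)

/-- The tie-breaking rule: the zero vector is chosen if it is one of the maximizers. -/
def PrefersZero (i : N) (l h y : E → ℝ) : Prop :=
  G.IsOwnArgmax i l h 0 → ∀ C : E, i ∈ C.1 → y C = 0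

/-- The state of the algorithm: the current network and the current capacities. -/
structure GDAState (E : Finset (Finset N)) where
  /-- current network -/
  weight : E → ℝ
  /-- current capacities -/
  cap : E → ℝ

/-- The algorithm starts from the zero network and the capacities of the game. -/
def gdaInit : GDAState E := ⟨0, G.capacity⟩

/-- Each agent of `U` raises the weights of its edges, within the current capacities and its
budget, so as to maximize its payoff. -/
def IsProposal (U : Finset N) (s : GDAState E) (p : E → ℝ) : Prop :=
  ∀ i ∈ U, G.IsOwnArgmax i s.weight s.cap p

/-- Each agent of `V` lowers the proposed weights of its edges, within its budget, so as to
maximize its payoff. -/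
def IsResponse (V : Finset N) (p q : E → ℝ) : Prop :=
  ∀ j ∈ V, G.IsOwnArgmax j 0 p q

/-- After the response `q` to the proposal `p`, the capacity of every edge whose proposed weight
has been lowered becomes its new weight. -/
noncomputable def gdaNext (s : GDAState E) (p q : E → ℝ) : GDAState E :=
  ⟨q, fun C => if q C < p C then q C else s.cap C⟩

/-- One full step of the algorithm, with arbitrary choices among maximizers. -/
def GDAStep (U V : Finset N) (s t : GDAState E) : Prop :=
  ∃ p q, G.IsProposal U s p ∧ G.IsResponse V p q ∧ t = gdaNext s p q

/-- The states that the algorithm can reach in finitely many steps. -/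
def GDAReachable (U V : Finset N) (s : GDAState E) : Prop :=
  Relation.ReflTransGen (G.GDAStep U V) G.gdaInit s

/-- The termination test: no agent of `U` can increase its payoff by raising weights, that is,
the current network is itself an admissible proposal. -/
def GDATerminal (U : Finset N) (s : GDAState E) : Prop := G.IsProposal U s s.weight

/-- An infinite run of the algorithm. -/
def IsGDARun (U V : Finset N) (s : ℕ → GDAState E) : Prop :=
  s 0 = G.gdaInit ∧ ∀ n, G.GDAStep U V (s n) (s (n + 1))

end NetworkGame

/-! By separability, freezing the externalities turns each payoff into a constant plus a sum of
concave functions of the agent's own weights. When a coalition deviates, each member sees the edges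
not containing it only lowered, so by positive externalities a gain in the original game is also a
gain in the frozen game. Frozen stability is therefore inherited (`FullyStable.of_freeze`).

In the frozen game one contented endpoint of `C` rules out blocking through `C`, and contentment
reduces to two elementary tests: raising `C`, and moving weight to `C` from one other edge
(`sum_le_of_stable`). The algorithm preserves a dichotomy (`GDAInvariant.next`): if the capacity of
an edge is intact, its endpoint in `U` refuses swaps towards it; if it has been lowered, its
endpoint in `V` refuses both swaps and raises.

A weight rises as long as its capacity stays intact, and can only fall afterwards. Every coordinate
is thus eventually monotone and converges, and the proposals have the same limit. On intact edges
the missing raise test holds at the proposals, and all tests pass to the limit by continuity and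
concavity (`GDAInvariant.exists_tendsto`). A terminal state is a fixed point of a step, so
termination is the case of a constant sequence. -/

namespace NetworkGame

/-! ### Concave functions of one variable -/

section Concave

variable {f g : ℝ → ℝ} {a b : ℝ}

/-- The points `u + e` and `v` are convex combinations of `u` and `v + e` with complementary
weights; adding the two concavity inequalities gives decreasing increments. -/
theorem concaveOn_increment_le (hf : ConcaveOn ℝ (Set.Icc 0 b) f) {u v e : ℝ}
    (hu : 0 ≤ u) (huv : u ≤ v) (he : 0 ≤ e) (hv : v + e ≤ b) :
    f (v + e) - f v ≤ f (u + e) - f u := by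
  rcases he.eq_or_lt with rfl | he
  · simp
  have hd : 0 < v + e - u := by linarith
  have hsum : (v - u) / (v + e - u) + e / (v + e - u) = 1 := by field_simp; ring
  have hsum' : e / (v + e - u) + (v - u) / (v + e - u) = 1 := by rw [add_comm]; exact hsum
  have hmu : u ∈ Set.Icc 0 b := ⟨hu, by linarith⟩
  have hmv : v + e ∈ Set.Icc 0 b := ⟨by linarith, hv⟩
  have hn1 : 0 ≤ (v - u) / (v + e - u) := div_nonneg (by linarith) hd.le
  have hn2 : 0 ≤ e / (v + e - u) := div_nonneg he.le hd.le
  have h1 := hf.2 hmu hmv hn1 hn2 hsum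
  have h2 := hf.2 hmu hmv hn2 hn1 hsum'
  have e1 : ((v - u) / (v + e - u)) • u + (e / (v + e - u)) • (v + e) = u + e := by
    simp only [smul_eq_mul]; field_simp; ring
  have e2 : (e / (v + e - u)) • u + ((v - u) / (v + e - u)) • (v + e) = v := by
    simp only [smul_eq_mul]; field_simp; ring
  rw [e1] at h1
  rw [e2] at h2
  simp only [smul_eq_mul] at h1 h2
  have h3 : (v - u) / (v + e - u) * f u + e / (v + e - u) * f u = f u := by
    rw [← add_mul, hsum, one_mul]
  have h4 : (v - u) / (v + e - u) * f (v + e) + e / (v + e - u) * f (v + e) = f (v + e) := by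
    rw [← add_mul, hsum, one_mul]
  linarith

/-- The function `t ↦ f (u + t) + g (v - t)` is concave, so if one positive step fails to improve on
its value at `0`, no longer step does. This turns tests confined to a small box into tests over the
full capacities. -/
theorem concaveOn_swap_extend (hf : ConcaveOn ℝ (Set.Icc 0 a) f)
    (hg : ConcaveOn ℝ (Set.Icc 0 b) g) {u v e d : ℝ} (hu : 0 ≤ u) (hv : v ≤ b)
    (he : 0 < e) (hed : e ≤ d) (hua : u + d ≤ a) (hdv : d ≤ v)
    (h : f (u + e) + g (v - e) ≤ f u + g v) : f (u + d) + g (v - d) ≤ f u + g v := by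
  have hd : 0 < d := he.trans_le hed
  have hsum : (1 - e / d) + e / d = 1 := by ring
  have hn1 : 0 ≤ 1 - e / d := by rw [sub_nonneg, div_le_one hd]; exact hed
  have hn2 : 0 < e / d := div_pos he hd
  have h1 := hf.2 (x := u) (y := u + d) ⟨hu, by linarith⟩ ⟨by linarith, hua⟩ hn1 hn2.le hsum
  have h2 := hg.2 (x := v) (y := v - d) ⟨by linarith, hv⟩ ⟨by linarith, by linarith⟩
    hn1 hn2.le hsum
  have e1 : (1 - e / d) • u + (e / d) • (u + d) = u + e := by
    simp only [smul_eq_mul]; field_simp; ring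
  have e2 : (1 - e / d) • v + (e / d) • (v - d) = v - e := by
    simp only [smul_eq_mul]; field_simp; ring
  rw [e1] at h1
  rw [e2] at h2
  simp only [smul_eq_mul] at h1 h2
  have h3 : (e / d) * (f (u + d) + g (v - d)) ≤ (e / d) * (f u + g v) := by linarith
  exact le_of_mul_le_mul_left h3 hn2

theorem concaveOn_raise_extend (hf : ConcaveOn ℝ (Set.Icc 0 a) f) {u e d : ℝ} (hu : 0 ≤ u)
    (he : 0 < e) (hed : e ≤ d) (hua : u + d ≤ a) (h : f (u + e) ≤ f u) : f (u + d) ≤ f u := by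
  have := concaveOn_swap_extend (g := fun _ => 0) (v := d) (b := d) hf
    (concaveOn_const 0 (convex_Icc 0 d)) hu le_rfl he hed hua le_rfl (by simpa using h)
  simpa using this

end Concave

/-! ### A single agent with separable concave payoff and a budget -/

/-- No smaller weight in `[0, c]` gives a larger value of `f`. -/
def NoGainLower (f : ℝ → ℝ) (c : ℝ) : Prop := ∀ t, 0 ≤ t → t ≤ c → f t ≤ f c

/-- The increment of `f` from `t` to `d` is at least the increment of the same length ending at `c`,
which is nonnegative. -/
theorem NoGainLower.mono {f : ℝ → ℝ} {b c d : ℝ} (hf : ConcaveOn ℝ (Set.Icc 0 b) f) (hc : c ≤ b)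
    (h : NoGainLower f c) (hdc : d ≤ c) : NoGainLower f d := by
  intro t ht htd
  have h1 := concaveOn_increment_le hf ht (v := t + (c - d)) (e := d - t) (by linarith)
    (by linarith) (by linarith)
  have h2 := h (t + (c - d)) (by linarith) (by linarith)
  have e1 : t + (c - d) + (d - t) = c := by ring
  have e2 : t + (d - t) = d := by ring
  rw [e1, e2] at h1
  linarith

section Agent

variable {ι : Type*}

/-- Moving weight from edge `D` to edge `C` does not increase the sum of values. -/
def SwapStable (f : ι → ℝ → ℝ) (α x : ι → ℝ) (C D : ι) : Prop :=
  ∀ e, 0 ≤ e → x C + e ≤ α C → e ≤ x D → f C (x C + e) + f D (x D - e) ≤ f C (x C) + f D (x D)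

/-- Raising the weight of `C` within capacity and budget does not increase its value. -/
def RaiseStable (f : ι → ℝ → ℝ) (α : ι → ℝ) (β : EReal) (S : Finset ι) (x : ι → ℝ) (C : ι) :
    Prop :=
  ∀ e, 0 ≤ e → x C + e ≤ α C → ((∑ D ∈ S, x D + e : ℝ) : EReal) ≤ β → f C (x C + e) ≤ f C (x C)

/-- `y` maximizes the separable payoff among vectors between `l` and `h` within the budget. -/
def IsBoxMax (f : ι → ℝ → ℝ) (β : EReal) (S : Finset ι) (l h y : ι → ℝ) : Prop :=
  ((∀ C ∈ S, l C ≤ y C ∧ y C ≤ h C) ∧ ((∑ C ∈ S, y C : ℝ) : EReal) ≤ β) ∧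
  ∀ w : ι → ℝ, (∀ C ∈ S, l C ≤ w C ∧ w C ≤ h C) → ((∑ C ∈ S, w C : ℝ) : EReal) ≤ β →
    ∑ C ∈ S, f C (w C) ≤ ∑ C ∈ S, f C (y C)

variable {f : ι → ℝ → ℝ} {α : ι → ℝ} {β : EReal} {S : Finset ι}

theorem coe_le_of_le {a b : ℝ} (hab : a ≤ b) (hb : (b : EReal) ≤ β) : (a : EReal) ≤ β :=
  (EReal.coe_le_coe_iff.2 hab).trans hb

theorem noGainLower_zero (g : ℝ → ℝ) : NoGainLower g 0 := fun t h0 h1 => by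
  rw [le_antisymm h1 h0]

theorem swapStable_of_eq_zero {x : ι → ℝ} {C D : ι} (h : x D = 0) : SwapStable f α x C D := by
  intro e he _ heD
  have : e = 0 := le_antisymm (h ▸ heD) he
  simp [this]

/-- A swap remains unprofitable if the weight of the lowered edge is smaller. -/
theorem SwapStable.mono (hf : ∀ C ∈ S, ConcaveOn ℝ (Set.Icc 0 (α C)) (f C)) {p q : ι → ℝ}
    {C D : ι} (hD : D ∈ S) (hs : SwapStable f α p C D) (hC : q C = p C) (hqp : q D ≤ p D)
    (hp : p D ≤ α D) : SwapStable f α q C D := by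
  intro e he hea heD
  rw [hC] at hea ⊢
  have h1 := hs e he hea (heD.trans hqp)
  -- Taking `e` away from `D` costs at least as much at the smaller weight `q D`.
  have h2 := concaveOn_increment_le (hf D hD) (u := q D - e) (v := p D - e) (e := e)
    (by linarith) (by linarith) he (by linarith)
  rw [sub_add_cancel, sub_add_cancel] at h2
  linarith

/-! ### Stability under limits -/

section Limit

variable {x : ι → ℝ} {y : ℕ → ι → ℝ}

theorem noGainLower_of_tendsto {g : ℝ → ℝ} {b c : ℝ} {v : ℕ → ℝ}
    (hg : ContinuousOn g (Set.Icc 0 b)) (hv : ∀ n, v n ∈ Set.Icc 0 b)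
    (h : ∀ n, NoGainLower g (v n)) (hc : Tendsto v atTop (𝓝 c)) : NoGainLower g c := by
  have hcm : c ∈ Set.Icc 0 b := isClosed_Icc.mem_of_tendsto hc (Eventually.of_forall hv)
  have key {w : ℕ → ℝ} {d : ℝ} (hw : ∀ n, w n ∈ Set.Icc 0 b) (hd : d ∈ Set.Icc 0 b)
      (hwd : Tendsto w atTop (𝓝 d)) : Tendsto (fun n => g (w n)) atTop (𝓝 (g d)) :=
    (hg d hd).tendsto.comp
      (tendsto_nhdsWithin_iff.2 ⟨hwd, Eventually.of_forall hw⟩)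
  intro t ht htc
  -- The test point `t` may exceed `v n`, so it is truncated; the truncation disappears in the
  -- limit.
  have hmin : Tendsto (fun n => min t (v n)) atTop (𝓝 t) := by
    simpa [min_eq_left htc] using (tendsto_const_nhds (x := t)).min hc
  refine le_of_tendsto_of_tendsto' (key (fun n => ?_) ⟨ht, htc.trans hcm.2⟩ hmin)
    (key hv hcm hc) fun n => h n _ (le_min ht (hv n).1) (min_le_right _ _)
  exact ⟨le_min ht (hv n).1, (min_le_right _ _).trans (hv n).2⟩

theorem swapStable_of_tendsto (hf : ∀ C ∈ S, ContinuousOn (f C) (Set.Icc 0 (α C)))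
    (hy : ∀ n, ∀ C ∈ S, y n C ∈ Set.Icc 0 (α C)) {C D : ι} (hC : C ∈ S) (hD : D ∈ S)
    (hx : Tendsto y atTop (𝓝 x)) (hs : ∀ᶠ n in atTop, SwapStable f α (y n) C D) :
    SwapStable f α x C D := by
  have hxt (B : ι) : Tendsto (fun n => y n B) atTop (𝓝 (x B)) := tendsto_pi_nhds.1 hx B
  have hxm (B : ι) (hB : B ∈ S) : x B ∈ Set.Icc 0 (α B) :=
    isClosed_Icc.mem_of_tendsto (hxt B) (Eventually.of_forall fun n => hy n B hB)
  have key {B : ι} (hB : B ∈ S) {w : ℕ → ℝ} {d : ℝ} (hw : ∀ n, w n ∈ Set.Icc 0 (α B))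
      (hd : d ∈ Set.Icc 0 (α B)) (hwd : Tendsto w atTop (𝓝 d)) :
      Tendsto (fun n => f B (w n)) atTop (𝓝 (f B d)) :=
    (hf B hB d hd).tendsto.comp
      (tendsto_nhdsWithin_iff.2 ⟨hwd, Eventually.of_forall hw⟩)
  intro e he hea heD
  -- The largest part of the swap `e` that is admissible at `y n`; it tends to `e`.
  set d : ℕ → ℝ := fun n => min e (min (y n D) (α C - y n C))
  have hd0 (n : ℕ) : 0 ≤ d n :=
    le_min he (le_min (hy n D hD).1 (by linarith [(hy n C hC).2]))
  have hdD (n : ℕ) : d n ≤ y n D := (min_le_right _ _).trans (min_le_left _ _)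
  have hdC (n : ℕ) : d n ≤ α C - y n C := (min_le_right _ _).trans (min_le_right _ _)
  have hde : Tendsto d atTop (𝓝 e) := by
    have h1 : min e (min (x D) (α C - x C)) = e :=
      min_eq_left (le_min heD (by linarith))
    have := (tendsto_const_nhds (x := e)).min
      ((hxt D).min ((tendsto_const_nhds (x := α C)).sub (hxt C)))
    rwa [h1] at this
  have hyC (n : ℕ) := hy n C hC
  have hyD (n : ℕ) := hy n D hD
  refine le_of_tendsto_of_tendsto
    ((key hC (w := fun n => y n C + d n) (fun n => ⟨by linarith [(hyC n).1, hd0 n],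
      by linarith [hdC n]⟩) ⟨by linarith [(hxm C hC).1], hea⟩ ((hxt C).add hde)).add
    (key hD (w := fun n => y n D - d n) (fun n => ⟨by linarith [hdD n],
      by linarith [(hyD n).2, hd0 n]⟩) ⟨by linarith, by linarith [(hxm D hD).2]⟩
      ((hxt D).sub hde)))
    ((key hC hyC (hxm C hC) (hxt C)).add (key hD hyD (hxm D hD) (hxt D))) ?_
  filter_upwards [hs] with n hn
  exact hn (d n) (hd0 n) (by linarith [hdC n]) (hdD n)

theorem raiseStable_of_tendsto (hf : ∀ C ∈ S, ContinuousOn (f C) (Set.Icc 0 (α C)))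
    (hconc : ∀ C ∈ S, ConcaveOn ℝ (Set.Icc 0 (α C)) (f C))
    (hy : ∀ n, ∀ C ∈ S, y n C ∈ Set.Icc 0 (α C)) {C : ι} (hC : C ∈ S)
    (hx : Tendsto y atTop (𝓝 x)) (hs : ∀ᶠ n in atTop, RaiseStable f α β S (y n) C) :
    RaiseStable f α β S x C := by
  have hxt (B : ι) : Tendsto (fun n => y n B) atTop (𝓝 (x B)) := tendsto_pi_nhds.1 hx B
  have hxm : x C ∈ Set.Icc 0 (α C) :=
    isClosed_Icc.mem_of_tendsto (hxt C) (Eventually.of_forall fun n => hy n C hC)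
  intro e he hea hβ
  rcases he.eq_or_lt with rfl | he
  · simp
  -- A raise by `e` may violate capacity or budget at every `y n`. Half of it leaves strict room in
  -- the limit, hence is eventually admissible, and concavity recovers the full raise.
  have hev1 : ∀ᶠ n in atTop, y n C + e / 2 < α C :=
    ((hxt C).add_const (e / 2)).eventually_lt_const (by linarith)
  have hev2 : ∀ᶠ n in atTop, ∑ B ∈ S, y n B + e / 2 < ∑ B ∈ S, x B + e :=
    ((tendsto_finsetSum S fun B _ => hxt B).add_const (e / 2)).eventually_lt_const (by linarith)
  refine concaveOn_raise_extend (hconc C hC) hxm.1 (half_pos he) (by linarith) hea ?_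
  have h1 : Tendsto (fun n => f C (y n C + e / 2)) atTop (𝓝 (f C (x C + e / 2))) := by
    refine (hf C hC _ ⟨by linarith [hxm.1], by linarith⟩).tendsto.comp
      (tendsto_nhdsWithin_iff.2 ⟨(hxt C).add_const _, ?_⟩)
    filter_upwards [hev1] with n hn
    exact ⟨by linarith [(hy n C hC).1], hn.le⟩
  have h2 : Tendsto (fun n => f C (y n C)) atTop (𝓝 (f C (x C))) :=
    (hf C hC _ hxm).tendsto.comp
      (tendsto_nhdsWithin_iff.2 ⟨hxt C, Eventually.of_forall fun n => hy n C hC⟩)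
  refine le_of_tendsto_of_tendsto h1 h2 ?_
  filter_upwards [hs, hev1, hev2] with n h3 h4 h5
  exact h3 _ (half_pos he).le h4.le (coe_le_of_le h5.le hβ)

end Limit

variable [DecidableEq ι]

theorem sum_apply_update (g : ι → ℝ → ℝ) {S : Finset ι} (y : ι → ℝ) {C : ι} (hC : C ∈ S)
    (t : ℝ) :
    ∑ B ∈ S, g B (Function.update y C t B) = ∑ B ∈ S, g B (y B) - g C (y C) + g C t := by
  rw [← Finset.add_sum_erase S _ hC, ← Finset.add_sum_erase S (fun B => g B (y B)) hC]
  have : ∑ B ∈ S.erase C, g B (Function.update y C t B) = ∑ B ∈ S.erase C, g B (y B) :=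
    Finset.sum_congr rfl fun B hB => by
      rw [Function.update_of_ne (Finset.ne_of_mem_erase hB)]
  rw [this, Function.update_self]
  ring

/-! ### Elementary moves at a maximizer -/

section BoxMax

variable {l h y : ι → ℝ}

theorem IsBoxMax.raise (hy : IsBoxMax f β S l h y) {C : ι} (hC : C ∈ S) {e : ℝ} (he : 0 ≤ e)
    (hh : y C + e ≤ h C) (hβ : ((∑ D ∈ S, y D + e : ℝ) : EReal) ≤ β) :
    f C (y C + e) ≤ f C (y C) := by
  have h1 := hy.2 (Function.update y C (y C + e)) ?_ ?_
  · rw [sum_apply_update f y hC] at h1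
    linarith
  · intro B hB
    rcases eq_or_ne B C with rfl | hBC
    · rw [Function.update_self]
      exact ⟨by linarith [(hy.1.1 B hB).1], hh⟩
    · rw [Function.update_of_ne hBC]
      exact hy.1.1 B hB
  · rw [sum_apply_update (fun _ t => t) y hC]
    convert hβ using 2
    ring

theorem IsBoxMax.lower (hy : IsBoxMax f β S l h y) {C : ι} (hC : C ∈ S) {t : ℝ} (hl : l C ≤ t)
    (ht : t ≤ y C) : f C t ≤ f C (y C) := by
  have h1 := hy.2 (Function.update y C t) ?_ ?_
  · rw [sum_apply_update f y hC] at h1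
    linarith
  · intro B hB
    rcases eq_or_ne B C with rfl | hBC
    · rw [Function.update_self]
      exact ⟨hl, ht.trans (hy.1.1 B hB).2⟩
    · rw [Function.update_of_ne hBC]
      exact hy.1.1 B hB
  · rw [sum_apply_update (fun _ t => t) y hC]
    exact coe_le_of_le (by linarith) hy.1.2

theorem IsBoxMax.swap (hy : IsBoxMax f β S l h y) {C D : ι} (hC : C ∈ S) (hD : D ∈ S)
    (hCD : D ≠ C) {e : ℝ} (he : 0 ≤ e) (hh : y C + e ≤ h C) (hl : l D ≤ y D - e) :
    f C (y C + e) + f D (y D - e) ≤ f C (y C) + f D (y D) := by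
  have h1 := hy.2 (Function.update (Function.update y C (y C + e)) D (y D - e)) ?_ ?_
  · rw [sum_apply_update f _ hD, sum_apply_update f y hC, Function.update_of_ne hCD] at h1
    linarith
  · intro B hB
    rcases eq_or_ne B D with rfl | hBD
    · rw [Function.update_self]
      exact ⟨hl, by linarith [(hy.1.1 B hB).2]⟩
    rw [Function.update_of_ne hBD]
    rcases eq_or_ne B C with rfl | hBC
    · rw [Function.update_self]
      exact ⟨by linarith [(hy.1.1 B hB).1], hh⟩
    · rw [Function.update_of_ne hBC]
      exact hy.1.1 B hB
  · rw [sum_apply_update (fun _ t => t) _ hD, sum_apply_update (fun _ t => t) y hC,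
      Function.update_of_ne hCD]
    exact coe_le_of_le (by linarith) hy.1.2

theorem IsBoxMax.noGainLower (hy : IsBoxMax f β S l h y) {C : ι} (hC : C ∈ S)
    (hl : NoGainLower (f C) (l C)) : NoGainLower (f C) (y C) := by
  intro t ht hty
  rcases le_total (l C) t with hlt | hlt
  · exact hy.lower hC hlt hty
  · exact (hl t ht hlt).trans (hy.lower hC le_rfl (hy.1.1 C hC).1)

end BoxMax

/-- If swaps towards an unrestricted edge `C` are unprofitable at `x`, then they are unprofitable
at every maximizer above `x`. -/
theorem IsBoxMax.swapStable (hf : ∀ C ∈ S, ConcaveOn ℝ (Set.Icc 0 (α C)) (f C)) {x a p : ι → ℝ}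
    (hp : IsBoxMax f β S x a p) {C D : ι} (hC : C ∈ S) (hD : D ∈ S) (hCD : D ≠ C)
    (hx : 0 ≤ x C) (ha : a C = α C) (hs : SwapStable f α x C D) : SwapStable f α p C D := by
  intro e he hea heD
  obtain ⟨hxC, -⟩ := hp.1.1 C hC
  obtain ⟨hxD, -⟩ := hp.1.1 D hD
  rcases le_total (x D) (p D - e) with hle | hle
  · exact hp.swap hC hD hCD he (ha ▸ hea) hle
  -- The swap is cut where `D` reaches its floor `x D`. Optimality of `p` controls the first part
  -- and `hs` the rest, since increments of `f C` are smaller above `p C` than above `x C`.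
  have h1 := hp.swap hC hD hCD (e := p D - x D) (by linarith) (by linarith) (by linarith)
  have h2 := hs (e - (p D - x D)) (by linarith) (by linarith) (by linarith)
  have h3 := concaveOn_increment_le (hf C hC) (u := x C) (v := p C + (p D - x D))
    (e := e - (p D - x D)) hx (by linarith) (by linarith) (by linarith)
  have e1 : p C + (p D - x D) + (e - (p D - x D)) = p C + e := by ring
  have e2 : x D - (e - (p D - x D)) = p D - e := by ring
  have e3 : p D - (p D - x D) = x D := by ring
  rw [e1] at h3
  rw [e2] at h2
  rw [e3] at h1
  linarith

/-! ### Contentment after a response -/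

section Response

variable {p q q' : ι → ℝ}

/-- As `C` was cut below its proposal, a small swap towards `C` was available and declined;
concavity extends this to all swaps within the original capacity. -/
theorem IsBoxMax.swapStable_of_lt (hf : ∀ C ∈ S, ConcaveOn ℝ (Set.Icc 0 (α C)) (f C))
    (hp : ∀ C ∈ S, p C ≤ α C) (hq : IsBoxMax f β S 0 p q) {C D : ι} (hC : C ∈ S) (hD : D ∈ S)
    (hCD : D ≠ C) (hlt : q C < p C) : SwapStable f α q C D := by
  intro e he hea heD
  rcases he.eq_or_lt with rfl | he
  · simp
  have hd : 0 < min e (p C - q C) := lt_min he (by linarith)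
  refine concaveOn_swap_extend (hf C hC) (hf D hD) (hq.1.1 C hC).1
    ((hq.1.1 D hD).2.trans (hp D hD)) hd (min_le_left _ _) hea heD ?_
  refine hq.swap hC hD hCD hd.le ?_ ?_
  · linarith [min_le_right e (p C - q C)]
  · have := min_le_left e (p C - q C)
    simp only [Pi.zero_apply]
    linarith

theorem IsBoxMax.raiseStable_of_lt (hf : ∀ C ∈ S, ConcaveOn ℝ (Set.Icc 0 (α C)) (f C))
    (hq : IsBoxMax f β S 0 p q) {C : ι} (hC : C ∈ S) (hlt : q C < p C) :
    RaiseStable f α β S q C := by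
  intro e he hea hβ
  rcases he.eq_or_lt with rfl | he
  · simp
  have hd : 0 < min e (p C - q C) := lt_min he (by linarith)
  refine concaveOn_raise_extend (hf C hC) (hq.1.1 C hC).1 hd (min_le_left _ _) hea ?_
  refine hq.raise hC hd.le ?_ (coe_le_of_le ?_ hβ)
  · linarith [min_le_right e (p C - q C)]
  · linarith [min_le_left e (p C - q C)]

/-- Once an agent is content with the weight of an edge `C`, it remains so after new proposals
that leave the weight of `C` unchanged: unprofitable swaps. -/
theorem IsBoxMax.swapStable_of_eq (hf : ∀ C ∈ S, ConcaveOn ℝ (Set.Icc 0 (α C)) (f C))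
    (hp : ∀ C ∈ S, q C ≤ p C ∧ p C ≤ α C)
    (hq' : IsBoxMax f β S 0 p q') {C D : ι} (hC : C ∈ S) (hD : D ∈ S) (hCD : D ≠ C)
    (hs : ∀ B ∈ S, B ≠ C → SwapStable f α q C B) (hr : RaiseStable f α β S q C)
    (heq : q' C = q C) : SwapStable f α q' C D := by
  rcases le_or_gt (q' D) (q D) with hle | hgt
  · exact (hs D hD hCD).mono hf hD heq hle ((hp D hD).1.trans (hp D hD).2)
  intro e he hea heD
  rcases he.eq_or_lt with rfl | he
  · simp
  by_cases hB : ∃ B ∈ S, q' B < q B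
  -- An edge `B` that lost weight has room for more, so moving weight from `D` to `B` does not pay
  -- at `q'`. Moving it from `B` to `C` did not pay at `q`, and `B` is worth at least as much at its
  -- lower weight. Composing the two moves rules out `D` to `C`.
  · obtain ⟨B, hBS, hB⟩ := hB
    have hBC : B ≠ C := by rintro rfl; exact hB.ne heq
    have hDB : D ≠ B := by rintro rfl; exact lt_asymm hB hgt
    have hd : 0 < min e (q B - q' B) := lt_min he (by linarith)
    refine concaveOn_swap_extend (hf C hC) (hf D hD) (hq'.1.1 C hC).1
      ((hq'.1.1 D hD).2.trans (hp D hD).2) hd (min_le_left _ _) hea heD ?_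
    have hm1 := min_le_left e (q B - q' B)
    have hm2 := min_le_right e (q B - q' B)
    generalize min e (q B - q' B) = d at hd hm1 hm2
    have hB0 : 0 ≤ q' B := (hq'.1.1 B hBS).1
    have h1 := hq'.swap hBS hD hDB hd.le (by linarith [(hp B hBS).1])
      (by simp only [Pi.zero_apply]; linarith)
    have h2 := concaveOn_increment_le (hf B hBS) (u := q' B) (v := q B - d) hB0 (by linarith) hd.le
      (by linarith [hp B hBS])
    rw [sub_add_cancel] at h2
    have h3 := hs B hBS hBC d hd.le (by linarith) (by linarith)
    rw [heq]
    linarith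
  · push Not at hB
    -- If no edge lost weight, the growth of `D` shows that the budget allowed raising `C` by `d` at
    -- `q`; that raise did not pay, and lowering `D` at `q'` does not pay either.
    have hd : 0 < min e (q' D - q D) := lt_min he (by linarith)
    refine concaveOn_swap_extend (hf C hC) (hf D hD) (hq'.1.1 C hC).1
      ((hq'.1.1 D hD).2.trans (hp D hD).2) hd (min_le_left _ _) hea heD ?_
    have hm1 := min_le_left e (q' D - q D)
    have hm2 := min_le_right e (q' D - q D)
    generalize min e (q' D - q D) = d at hd hm1 hm2
    have hsum : ∑ B ∈ S, q B + d ≤ ∑ B ∈ S, q' B := by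
      rw [← Finset.add_sum_erase S q hD, ← Finset.add_sum_erase S q' hD]
      have := Finset.sum_le_sum (s := S.erase D) fun B hBS => hB B (Finset.mem_of_mem_erase hBS)
      linarith
    have h1 := hr d hd.le (by linarith) (coe_le_of_le hsum hq'.1.2)
    have h2 := hq'.lower hD (t := q' D - d) (by simp only [Pi.zero_apply]; linarith) (by linarith)
    rw [heq]
    linarith

/-- Once an agent is content with the weight of an edge `C`, it remains so after new proposals
that leave the weight of `C` unchanged: unprofitable raises. -/
theorem IsBoxMax.raiseStable_of_eq (hf : ∀ C ∈ S, ConcaveOn ℝ (Set.Icc 0 (α C)) (f C))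
    (hp : ∀ C ∈ S, q C ≤ p C ∧ p C ≤ α C)
    (hq' : IsBoxMax f β S 0 p q') {C : ι} (hC : C ∈ S)
    (hs : ∀ B ∈ S, B ≠ C → SwapStable f α q C B) (hr : RaiseStable f α β S q C)
    (heq : q' C = q C) : RaiseStable f α β S q' C := by
  intro e he hea hβ
  rcases he.eq_or_lt with rfl | he
  · simp
  by_cases hB : ∃ B ∈ S, q' B < q B
  -- The budget left for raising `C` could raise `B` instead, which does not pay at `q'`; the old
  -- swap test from `B` to `C` compares the two raises.
  · obtain ⟨B, hBS, hB⟩ := hB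
    have hBC : B ≠ C := by rintro rfl; exact hB.ne heq
    have hd : 0 < min e (q B - q' B) := lt_min he (by linarith)
    refine concaveOn_raise_extend (hf C hC) (hq'.1.1 C hC).1 hd (min_le_left _ _) hea ?_
    have hm1 := min_le_left e (q B - q' B)
    have hm2 := min_le_right e (q B - q' B)
    generalize min e (q B - q' B) = d at hd hm1 hm2
    have hB0 : 0 ≤ q' B := (hq'.1.1 B hBS).1
    have h1 := hq'.raise hBS hd.le (by linarith [(hp B hBS).1]) (coe_le_of_le (by linarith) hβ)
    have h2 := concaveOn_increment_le (hf B hBS) (u := q' B) (v := q B - d) hB0 (by linarith) hd.le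
      (by linarith [hp B hBS])
    rw [sub_add_cancel] at h2
    have h3 := hs B hBS hBC d hd.le (by linarith) (by linarith)
    rw [heq]
    linarith
  · push Not at hB
    rw [heq] at hea ⊢
    refine hr e he.le hea (coe_le_of_le ?_ hβ)
    linarith [Finset.sum_le_sum hB]

end Response

/-- If neither raising `C` nor swapping weight towards `C` is profitable, then an agent cannot
gain by raising `C` and lowering other edges. -/
theorem sum_le_of_stable (hf : ∀ C ∈ S, ConcaveOn ℝ (Set.Icc 0 (α C)) (f C)) {x y : ι → ℝ}
    {C : ι} (hC : C ∈ S) (hx : ∀ D ∈ S, x D ∈ Set.Icc 0 (α D))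
    (hlow : ∀ D ∈ S, NoGainLower (f D) (x D))
    (hs : ∀ D ∈ S, D ≠ C → SwapStable f α x C D) (hr : RaiseStable f α β S x C)
    (hyC : x C ≤ y C) (hyα : y C ≤ α C) (hy : ∀ D ∈ S, D ≠ C → 0 ≤ y D ∧ y D ≤ x D)
    (hβ : ((∑ D ∈ S, y D : ℝ) : EReal) ≤ β) :
    ∑ D ∈ S, f D (y D) ≤ ∑ D ∈ S, f D (x D) := by
  -- Induction on the set `T` of edges whose freed weight may finance the raise of `C`; the budget
  -- hypothesis credits exactly this weight.
  have key : ∀ T ⊆ S.erase C, ∀ e, 0 ≤ e → x C + e ≤ α C →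
      ((∑ D ∈ S, x D + e - ∑ D ∈ T, (x D - y D) : ℝ) : EReal) ≤ β →
      f C (x C + e) - f C (x C) ≤ ∑ D ∈ T, (f D (x D) - f D (y D)) := by
    intro T
    induction T using Finset.induction_on with
    | empty =>
      intro _ e he hea hβ
      have := hr e he hea (by simpa using hβ)
      simpa using this
    | insert D T hDT ih =>
      intro hT e he hea hβ
      have hDm := hT (Finset.mem_insert_self D T)
      have hDS := Finset.mem_of_mem_erase hDm
      have hDC := Finset.ne_of_mem_erase hDm
      obtain ⟨hyD0, hyDx⟩ := hy D hDS hDC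
      have hDf := hf D hDS
      have hDα := (hx D hDS).2
      have hCx := (hx C hC).1
      have hDlow := hlow D hDS
      rw [Finset.sum_insert hDT] at hβ ⊢
      rcases le_total e (x D - y D) with hle | hle
      -- Here `D` alone finances the whole raise; the remaining reductions are only losses.
      · have h2 := hs D hDS hDC e he hea (by linarith)
        have h3 := hDlow.mono hDf hDα (d := x D - e) (by linarith)
          (y D) hyD0 (by linarith)
        have h4 : 0 ≤ ∑ B ∈ T, (f B (x B) - f B (y B)) := Finset.sum_nonneg fun B hB => by
          have hBm := hT (Finset.mem_insert_of_mem hB)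
          have hBS := Finset.mem_of_mem_erase hBm
          have := hy B hBS (Finset.ne_of_mem_erase hBm)
          exact sub_nonneg.2 (hlow B hBS _ this.1 this.2)
        linarith
      -- All the weight freed at `D` pays for one part of the raise, which by decreasing increments
      -- may be charged at `x C`; the rest is left to `T`.
      · have h2 := hs D hDS hDC (x D - y D) (by linarith) (by linarith) (by linarith)
        have h4 := concaveOn_increment_le (hf C hC) (u := x C) (v := x C + (e - (x D - y D)))
          (e := x D - y D) hCx (by linarith) (by linarith) (by linarith)
        have h5 := ih ((Finset.subset_insert D T).trans hT) (e - (x D - y D)) (by linarith)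
          (by linarith) (coe_le_of_le (by linarith) hβ)
        have e1 : x C + (e - (x D - y D)) + (x D - y D) = x C + e := by ring
        rw [e1] at h4
        rw [sub_sub_cancel] at h2
        linarith
  have h := key (S.erase C) subset_rfl (y C - x C) (by linarith) (by linarith) ?_
  · rw [add_sub_cancel, Finset.sum_sub_distrib] at h
    rw [← Finset.add_sum_erase S _ hC, ← Finset.add_sum_erase S (fun D => f D (x D)) hC]
    linarith
  · convert hβ using 2
    rw [Finset.sum_sub_distrib, ← Finset.add_sum_erase S x hC, ← Finset.add_sum_erase S y hC]
    ring

theorem exists_isBoxMax [Fintype ι] (hf : ∀ C ∈ S, ContinuousOn (f C) (Set.Icc 0 (α C)))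
    {l h : ι → ℝ} (hl : ∀ C ∈ S, 0 ≤ l C) (hlh : ∀ C ∈ S, l C ≤ h C) (hh : ∀ C ∈ S, h C ≤ α C)
    (hβ : ((∑ C ∈ S, l C : ℝ) : EReal) ≤ β) : ∃ y, IsBoxMax f β S l h y := by
  -- Coordinates outside `S` are pinned to `0` to make the feasible set compact.
  let K : Set (ι → ℝ) := Set.univ.pi (fun C => if C ∈ S then Set.Icc (l C) (h C) else {0}) ∩
    {y | ((∑ C ∈ S, y C : ℝ) : EReal) ≤ β}
  have hmem (y : ι → ℝ) (hy : ∀ C ∈ S, l C ≤ y C ∧ y C ≤ h C)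
      (hyβ : ((∑ C ∈ S, y C : ℝ) : EReal) ≤ β) : (fun C => if C ∈ S then y C else 0) ∈ K := by
    refine ⟨fun C _ => ?_, ?_⟩
    · by_cases hC : C ∈ S
      · simpa [hC] using hy C hC
      · simp [hC]
    · rw [Set.mem_ofPred_eq, Finset.sum_congr rfl fun C hC => if_pos hC]
      exact hyβ
  have hK : IsCompact K := by
    refine (isCompact_univ_pi fun C => ?_).inter_right (isClosed_le ?_ continuous_const)
    · split_ifs
      exacts [isCompact_Icc, isCompact_singleton]
    · exact continuous_coe_real_ereal.comp (by fun_prop)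
  have hKS {y : ι → ℝ} (hy : y ∈ K) {C : ι} (hC : C ∈ S) : l C ≤ y C ∧ y C ≤ h C := by
    simpa [hC] using hy.1 C (Set.mem_univ C)
  have hcont : ContinuousOn (fun y : ι → ℝ => ∑ C ∈ S, f C (y C)) K := by
    refine continuousOn_finsetSum S fun C hC => ?_
    refine (hf C hC).comp (continuous_apply C).continuousOn fun y hy => ?_
    exact ⟨(hl C hC).trans (hKS hy hC).1, (hKS hy hC).2.trans (hh C hC)⟩
  obtain ⟨y, hyK, hy⟩ := hK.exists_isMaxOn
    ⟨_, hmem l (fun C hC => ⟨le_rfl, hlh C hC⟩) hβ⟩ hcont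
  refine ⟨y, ⟨fun C hC => hKS hyK hC, hyK.2⟩, fun w hw hwβ => ?_⟩
  exact (Finset.sum_congr rfl fun C hC => by simp only [if_pos hC]).trans_le (hy (hmem w hw hwβ))

end Agent

variable {N : Type*} [DecidableEq N] {E : Finset (Finset N)}

/-! ### Games without externalities -/

/-- The edges containing agent `i`. -/
def edgesOf (E : Finset (Finset N)) (i : N) : Finset E := {C : E | i ∈ C.1}

@[simp] theorem mem_edgesOf {i : N} {C : E} : C ∈ edgesOf E i ↔ i ∈ C.1 := by simp [edgesOf]

theorem splice_of_mem {T : Finset N} {i : N} (hi : i ∈ T) (y w : E → ℝ) {C : E} (hC : i ∈ C.1) :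
    splice T y w C = y C := if_pos ⟨i, hi, hC⟩

theorem splice_singleton_of_notMem {i : N} (y w : E → ℝ) {C : E} (hC : i ∉ C.1) :
    splice {i} y w C = w C := if_neg (by simpa using hC)

/-- The payoff of agent `i` is, up to the constant `K i`, the sum of the concave continuous
functions `f i C` of the weights of its edges. -/
structure IsOwnDecomposition (H : NetworkGame N E) (f : N → E → ℝ → ℝ) (K : N → ℝ) : Prop where
  concave : ∀ i C, ConcaveOn ℝ (Set.Icc 0 (H.capacity C)) (f i C)
  continuous : ∀ i C, ContinuousOn (f i C) (Set.Icc 0 (H.capacity C))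
  payoff_eq : ∀ i y, (∀ C : E, i ∈ C.1 → y C ∈ Set.Icc 0 (H.capacity C)) →
    H.payoff i y = ∑ C ∈ edgesOf E i, f i C (y C) + K i

variable {H : NetworkGame N E} {f : N → E → ℝ → ℝ} {K : N → ℝ} {U V : Finset N}

theorem IsOwnDecomposition.payoff_splice (hH : H.IsOwnDecomposition f K) {i : N} {T : Finset N}
    (hi : i ∈ T) {y : E → ℝ} (hy : ∀ C : E, i ∈ C.1 → y C ∈ Set.Icc 0 (H.capacity C))
    (w : E → ℝ) : H.payoff i (splice T y w) = ∑ C ∈ edgesOf E i, f i C (y C) + K i := by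
  rw [hH.payoff_eq i _ fun C hC => by rw [splice_of_mem hi y w hC]; exact hy C hC]
  congr 1
  exact Finset.sum_congr rfl fun C hC => by rw [splice_of_mem hi y w (mem_edgesOf.1 hC)]

theorem IsOwnDecomposition.isOwnArgmax_iff (hH : H.IsOwnDecomposition f K) {i : N}
    {l h y : E → ℝ} (hl : ∀ C : E, i ∈ C.1 → 0 ≤ l C)
    (hh : ∀ C : E, i ∈ C.1 → h C ≤ H.capacity C) :
    H.IsOwnArgmax i l h y ↔ IsBoxMax (f i) (H.budget i) (edgesOf E i) l h y := by
  have hmem {w : E → ℝ} : w ∈ H.ownFeasible i l h ↔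
      (∀ C ∈ edgesOf E i, l C ≤ w C ∧ w C ≤ h C) ∧
        ((∑ C ∈ edgesOf E i, w C : ℝ) : EReal) ≤ H.budget i := by
    simp only [mem_edgesOf]
    rfl
  have hval {w : E → ℝ} (hw : ∀ C ∈ edgesOf E i, l C ≤ w C ∧ w C ≤ h C) :
      H.payoff i (splice {i} w 0) = ∑ C ∈ edgesOf E i, f i C (w C) + K i :=
    hH.payoff_splice (Finset.mem_singleton_self i)
      (fun C hC => ⟨(hl C hC).trans (hw C (mem_edgesOf.2 hC)).1,
        (hw C (mem_edgesOf.2 hC)).2.trans (hh C hC)⟩) 0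
  rw [IsOwnArgmax, IsBoxMax, hmem]
  refine and_congr_right fun hy => ⟨fun hmax w hw hwβ => ?_, fun hmax w hw => ?_⟩
  · have := hmax w (hmem.2 ⟨hw, hwβ⟩)
    rw [hval hw, hval hy.1] at this
    linarith
  · have hw := hmem.1 hw
    rw [hval hw.1, hval hy.1]
    linarith [hmax w hw.1 hw.2]

theorem IsOwnArgmax.congr {i : N} {l h y p : E → ℝ} (hy : H.IsOwnArgmax i l h y)
    (hp : ∀ C : E, i ∈ C.1 → p C = y C) : H.IsOwnArgmax i l h p := by
  have hload : load p i = load y i :=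
    Finset.sum_congr rfl fun C hC => hp C (mem_edgesOf.1 hC)
  have hsplice : splice {i} p 0 = splice {i} y 0 := by
    funext C
    by_cases hC : i ∈ C.1
    · rw [splice_of_mem (Finset.mem_singleton_self i) _ _ hC,
        splice_of_mem (Finset.mem_singleton_self i) _ _ hC, hp C hC]
    · rw [splice_singleton_of_notMem _ _ hC, splice_singleton_of_notMem _ _ hC]
  refine ⟨⟨fun C hC => ?_, ?_⟩, ?_⟩
  · rw [hp C hC]
    exact hy.1.1 C hC
  · rw [hload]
    exact hy.1.2
  · rw [hsplice]
    exact hy.2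

/-! ### Freezing the externalities -/

section Freeze

variable {G : NetworkGame N E} {g : E → N → ℝ → ℝ}

theorem payoff_eq_of_separable
    (hg : ∀ x ∈ G.capacityBox, ∀ i, G.payoff i x = ∑ C : E, g C i (x C)) {x : E → ℝ}
    (hx : x ∈ G.capacityBox) (i : N) :
    G.payoff i x = ∑ C ∈ edgesOf E i, g C i (x C) + ∑ C : E with i ∉ C.1, g C i (x C) := by
  rw [hg x hx i, edgesOf, Finset.sum_filter_add_sum_filter_not]

theorem payoff_splice_of_separable
    (hg : ∀ x ∈ G.capacityBox, ∀ i, G.payoff i x = ∑ C : E, g C i (x C)) {i : N} {y w : E → ℝ}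
    (hy : ∀ C : E, i ∈ C.1 → y C ∈ Set.Icc 0 (G.capacity C)) (hw : w ∈ G.capacityBox) :
    G.payoff i (splice {i} y w) =
      ∑ C ∈ edgesOf E i, g C i (y C) + ∑ C : E with i ∉ C.1, g C i (w C) := by
  have hi := Finset.mem_singleton_self i
  rw [payoff_eq_of_separable hg]
  · congr 1
    · exact Finset.sum_congr rfl fun C hC => by rw [splice_of_mem hi y w (mem_edgesOf.1 hC)]
    · exact Finset.sum_congr rfl fun C hC => by
        rw [splice_singleton_of_notMem y w (Finset.mem_filter.1 hC).2]
  · intro C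
    by_cases hC : i ∈ C.1
    · rw [splice_of_mem hi y w hC]
      exact hy C hC
    · rw [splice_singleton_of_notMem y w hC]
      exact hw C

/-- A component of a separable payoff is the payoff along one coordinate, up to a constant. -/
theorem separable_component_eq
    (hg : ∀ x ∈ G.capacityBox, ∀ i, G.payoff i x = ∑ C : E, g C i (x C)) (i : N) (C : E) :
    ∃ c, Set.EqOn (g C i) (fun t => G.payoff i (Function.update 0 C t) + c)
      (Set.Icc 0 (G.capacity C)) := by
  -- The constant removes the contribution of all other edges at weight `0`.
  refine ⟨g C i 0 - ∑ D : E, g D i 0, fun t ht => ?_⟩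
  have hbox : Function.update (0 : E → ℝ) C t ∈ G.capacityBox := fun D => by
    rcases eq_or_ne D C with rfl | hD
    · rwa [Function.update_self]
    · rw [Function.update_of_ne hD]
      exact ⟨le_rfl, (G.capacity_mem D).1⟩
  have h := sum_apply_update (fun D => g D i) (0 : E → ℝ) (Finset.mem_univ C) t
  simp only [Pi.zero_apply] at h
  simp only [hg _ hbox i, h]
  ring

/-- The frozen edges contribute only the constant. Each component inherits concavity and continuity
from the payoff along a coordinate line through `0`. -/
theorem isOwnDecomposition_freeze
    (hg : ∀ x ∈ G.capacityBox, ∀ i, G.payoff i x = ∑ C : E, g C i (x C))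
    (hcont : G.IsContinuous) (hconc : G.IsConcave) {z : E → ℝ} (hz : z ∈ G.capacityBox) :
    (G.freeze z).IsOwnDecomposition (fun i C => g C i)
      (fun i => ∑ C : E with i ∉ C.1, g C i (z C)) where
  concave i C := by
    obtain ⟨c, hc⟩ := separable_component_eq hg i C
    have h0 : (0 : E → ℝ) ∈ networks E := fun D => ⟨le_rfl, zero_le_one⟩
    have hsub : Set.Icc 0 (G.capacity C) ⊆ Set.Icc (0 : ℝ) 1 :=
      Set.Icc_subset_Icc_right (G.capacity_mem C).2
    exact (((hconc i C 0 h0).subset hsub (convex_Icc _ _)).add_const c).congr hc.symm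
  continuous i C := by
    obtain ⟨c, hc⟩ := separable_component_eq hg i C
    refine ContinuousOn.congr ?_ hc
    refine ((hcont i).comp (by fun_prop) fun t ht D => ?_).add continuousOn_const
    rcases eq_or_ne D C with rfl | hD
    · rw [Function.update_self]
      exact ⟨ht.1, ht.2.trans (G.capacity_mem D).2⟩
    · rw [Function.update_of_ne hD]
      exact ⟨le_rfl, zero_le_one⟩
  payoff_eq i y hy := payoff_splice_of_separable hg hy hz

/-- Full stability for the game with frozen externalities is inherited by the original game. -/
theorem FullyStable.of_freeze
    (hg : ∀ x ∈ G.capacityBox, ∀ i, G.payoff i x = ∑ C : E, g C i (x C))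
    (hpos : G.HasPositiveExternalities) {z : E → ℝ}
    (hz : z ∈ G.capacityBox) {x : E → ℝ} (hx : (G.freeze z).FullyStable x) : G.FullyStable x := by
  obtain ⟨hfeas, hlow, hblock⟩ := hx
  have hbox : x ∈ G.capacityBox := hfeas.1
  have hsplice {i : N} {T : Finset N} (hi : i ∈ T) {y w : E → ℝ} :
      splice {i} (splice T y w) z = splice {i} y z := by
    funext C
    by_cases hC : i ∈ C.1
    · simp only [splice_of_mem (Finset.mem_singleton_self i) _ _ hC, splice_of_mem hi _ _ hC]
    · simp only [splice_singleton_of_notMem _ _ hC]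
  have hxz (i : N) := payoff_splice_of_separable hg (i := i) (fun C _ => hbox C) hz
  refine ⟨hfeas, fun i y hy hyx => ?_, fun C y hy hC hother hgain => ?_⟩
  · have hyb (C : E) (hC : i ∈ C.1) : y C ∈ Set.Icc 0 (G.capacity C) :=
      ⟨(hy C).1, (hyx C hC).trans (hbox C).2⟩
    have h := hlow i y hy hyx
    simp only [freeze, hsplice (Finset.mem_singleton_self i)] at h
    rw [payoff_splice_of_separable hg hyb hz, hxz i] at h
    rw [payoff_splice_of_separable hg hyb hbox, payoff_eq_of_separable hg hbox]
    linarith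
  · refine hblock C y hy hC hother fun i hi => ?_
    set w := splice C.1 y x with hw
    have hwbox : w ∈ G.capacityBox := fun D => by
      rw [hw, splice]
      split_ifs
      exacts [hy D, hbox D]
    have hwx (D : E) (hD : i ∉ D.1) : w D ≤ x D := by
      rw [hw, splice]
      split_ifs with h
      · exact hother D (by rintro rfl; exact hD hi) h
      · exact le_rfl
    -- Since `C` contains `i`, the deviation does not raise any edge outside `i`, so the external
    -- part of the payoff cannot increase and the gain must come from the edges of `i`.
    have hext := hpos i x hfeas w
      (fun D => ⟨(hwbox D).1, (hwbox D).2.trans (G.capacity_mem D).2⟩) hwx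
    have hlt := hgain i hi
    have hwy : ∑ D ∈ edgesOf E i, g D i (w D) = ∑ D ∈ edgesOf E i, g D i (y D) :=
      Finset.sum_congr rfl fun D hD => by rw [hw, splice_of_mem hi y x (mem_edgesOf.1 hD)]
    rw [payoff_splice_of_separable hg (fun D _ => hbox D) hwbox,
      payoff_eq_of_separable hg hbox] at hext
    rw [payoff_eq_of_separable hg hbox, payoff_eq_of_separable hg hwbox,
      hwy] at hlt
    simp only [freeze, hw, hsplice hi]
    rw [payoff_splice_of_separable hg (fun D _ => hy D) hz, hxz i]
    linarith

end Freeze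

/-! ### Generalized Deferred Acceptance -/

/-- Properties of the states of the algorithm: agents of `U` are content with the edges whose
capacity is intact, and agents of `V` with the edges whose capacity has been lowered. -/
structure GDAInvariant (H : NetworkGame N E) (f : N → E → ℝ → ℝ) (U V : Finset N)
    (s : GDAState E) : Prop where
  nonneg : ∀ C, 0 ≤ s.weight C
  le_cap : ∀ C, s.weight C ≤ s.cap C
  cap_le : ∀ C, s.cap C ≤ H.capacity C
  eq_cap : ∀ C, s.cap C ≠ H.capacity C → s.weight C = s.cap C
  load_le : ∀ i, (load s.weight i : EReal) ≤ H.budget i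
  low : ∀ i, ∀ C : E, i ∈ C.1 → NoGainLower (f i C) (s.weight C)
  swap_left : ∀ i ∈ U, ∀ C : E, i ∈ C.1 → s.cap C = H.capacity C →
    ∀ D : E, i ∈ D.1 → D ≠ C → SwapStable (f i) H.capacity s.weight C D
  swap_right : ∀ j ∈ V, ∀ C : E, j ∈ C.1 → s.cap C ≠ H.capacity C →
    ∀ D : E, j ∈ D.1 → D ≠ C → SwapStable (f j) H.capacity s.weight C D
  raise_right : ∀ j ∈ V, ∀ C : E, j ∈ C.1 → s.cap C ≠ H.capacity C →
    RaiseStable (f j) H.capacity (H.budget j) (edgesOf E j) s.weight C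

theorem gdaInvariant_init : GDAInvariant H f U V H.gdaInit where
  nonneg _ := le_rfl
  le_cap C := (H.capacity_mem C).1
  cap_le _ := le_rfl
  eq_cap _ h := absurd rfl h
  load_le i := by
    have : load (E := E) (0 : E → ℝ) i = 0 := Finset.sum_const_zero
    exact (congrArg ((↑) : ℝ → EReal) this).trans_le (H.budget_pos i).le
  low i C _ := noGainLower_zero _
  swap_left _ _ _ _ _ _ _ _ := swapStable_of_eq_zero rfl
  swap_right _ _ _ _ h := absurd rfl h
  raise_right _ _ _ _ h := absurd rfl h

theorem GDAInvariant.isBoxMax_proposal (hH : H.IsOwnDecomposition f K) {s : GDAState E}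
    {p : E → ℝ} (hs : GDAInvariant H f U V s) (hp : H.IsProposal U s p) {i : N} (hi : i ∈ U) :
    IsBoxMax (f i) (H.budget i) (edgesOf E i) s.weight s.cap p :=
  (hH.isOwnArgmax_iff (fun C _ => hs.nonneg C) fun C _ => hs.cap_le C).1 (hp i hi)

theorem GDAInvariant.swapStable_proposal (hH : H.IsOwnDecomposition f K)
    {s : GDAState E} {p : E → ℝ} (hs : GDAInvariant H f U V s) (hp : H.IsProposal U s p)
    {i : N} (hi : i ∈ U) {C D : E}
    (hC : i ∈ C.1) (hD : i ∈ D.1) (hDC : D ≠ C) (hcap : s.cap C = H.capacity C) :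
    SwapStable (f i) H.capacity p C D :=
  (hs.isBoxMax_proposal hH hp hi).swapStable (fun B _ => hH.concave i B) (mem_edgesOf.2 hC)
    (mem_edgesOf.2 hD) hDC (hs.nonneg C) hcap (hs.swap_left i hi C hC hcap D hD hDC)

/-- This is available at proposals only: a response may lower other edges of `i` and free its
budget. Hence the invariant has no raise condition for `U`. -/
theorem GDAInvariant.raiseStable_proposal (hH : H.IsOwnDecomposition f K)
    {s : GDAState E} {p : E → ℝ} (hs : GDAInvariant H f U V s) (hp : H.IsProposal U s p)
    {i : N} (hi : i ∈ U) {C : E}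
    (hC : i ∈ C.1) (hcap : s.cap C = H.capacity C) :
    RaiseStable (f i) H.capacity (H.budget i) (edgesOf E i) p C := fun _ he hea hβ =>
  (hs.isBoxMax_proposal hH hp hi).raise (mem_edgesOf.2 hC) he (hcap ▸ hea) hβ

/-- A network satisfying the limit conditions of the algorithm is fully stable. -/
theorem IsOwnDecomposition.fullyStable (hH : H.IsOwnDecomposition f K) {x : E → ℝ}
    (hx : x ∈ H.feasible) (hlow : ∀ i, ∀ C : E, i ∈ C.1 → NoGainLower (f i C) (x C))
    (hst : ∀ C : E, ∃ i ∈ C.1,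
      (∀ D : E, i ∈ D.1 → D ≠ C → SwapStable (f i) H.capacity x C D) ∧
      RaiseStable (f i) H.capacity (H.budget i) (edgesOf E i) x C) : H.FullyStable x := by
  refine ⟨hx, fun i y hy hyx => ?_, fun C y hy hC hother hgain => ?_⟩
  · rw [hH.payoff_splice (Finset.mem_singleton_self i)
      (fun C hC => ⟨(hy C).1, (hyx C hC).trans (hx.1 C).2⟩) x, hH.payoff_eq i x fun C _ => hx.1 C]
    gcongr with C hC
    exact hlow i C (mem_edgesOf.1 hC) _ (hy C).1 (hyx C (mem_edgesOf.1 hC))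
  · by_contra! hno
    -- Blocking requires a strict gain for every member, so one contented member suffices.
    obtain ⟨i, hi, hsw, hr⟩ := hst C
    refine (hgain i hi).not_ge ?_
    rw [hH.payoff_splice hi (fun D _ => hy D) x, hH.payoff_eq i x fun D _ => hx.1 D]
    gcongr 1
    refine sum_le_of_stable (fun D _ => hH.concave i D) (mem_edgesOf.2 hi) (fun D _ => hx.1 D)
      (fun D hD => hlow i D (mem_edgesOf.1 hD)) (fun D hD => hsw D (mem_edgesOf.1 hD)) hr hC
      (hy C).2 (fun D hD hDC => ⟨(hy D).1, hother D hDC ⟨i, hi, mem_edgesOf.1 hD⟩⟩) (hno i hi)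

variable [Fintype N]

/-! ### Bipartitions -/

theorem IsBipartition.exists_left (hb : IsBipartition E U V) (C : E) : ∃ i ∈ U, i ∈ C.1 := by
  obtain ⟨i, hi, j, hj, h⟩ := hb.2.2 C.1 C.2
  exact ⟨i, hi, by simp [h]⟩

theorem IsBipartition.symm (hb : IsBipartition E U V) : IsBipartition E V U := by
  refine ⟨hb.1.symm, Finset.union_comm V U ▸ hb.2.1, fun C hC => ?_⟩
  obtain ⟨i, hi, j, hj, h⟩ := hb.2.2 C hC
  exact ⟨j, hj, i, hi, h.trans (Finset.pair_comm i j)⟩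

theorem IsBipartition.mem_or (hb : IsBipartition E U V) (i : N) : i ∈ U ∨ i ∈ V := by
  rw [← Finset.mem_union, hb.2.1]
  exact Finset.mem_univ i

theorem IsBipartition.left_unique (hb : IsBipartition E U V) {C : E} {i i' : N} (hi : i ∈ U)
    (hi' : i' ∈ U) (hC : i ∈ C.1) (hC' : i' ∈ C.1) : i = i' := by
  obtain ⟨k, hk, j, hj, h⟩ := hb.2.2 C.1 C.2
  have hne {m : N} (hm : m ∈ U) (hmC : m ∈ C.1) : m = k := by
    rw [h, Finset.mem_insert, Finset.mem_singleton] at hmC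
    exact hmC.resolve_right fun hmj => Finset.disjoint_left.1 hb.1 hm (hmj ▸ hj)
  rw [hne hi hC, hne hi' hC']

/-- Each edge has exactly one endpoint in `U`, so independent choices of these agents never
conflict. -/
theorem IsBipartition.exists_glue (hb : IsBipartition E U V) (y : N → E → ℝ) :
    ∃ p : E → ℝ, ∀ i ∈ U, ∀ C : E, i ∈ C.1 → p C = y i C := by
  choose k hkU hkC using hb.exists_left
  exact ⟨fun C => y (k C) C, fun i hi C hC => by rw [hb.left_unique hi (hkU C) hC (hkC C)]⟩

theorem IsBipartition.exists_isOwnArgmax (hb : IsBipartition E U V) {l h : E → ℝ}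
    (hex : ∀ i ∈ U, ∃ y, H.IsOwnArgmax i l h y) :
    ∃ p : E → ℝ, (∀ i ∈ U, H.IsOwnArgmax i l h p) ∧ ∀ i ∈ U, H.PrefersZero i l h p := by
  classical
  have hex' (i : N) : ∃ y, i ∈ U → H.IsOwnArgmax i l h y ∧ H.PrefersZero i l h y := by
    by_cases hi : i ∈ U
    · by_cases h0 : H.IsOwnArgmax i l h 0
      · exact ⟨0, fun _ => ⟨h0, fun _ _ _ => rfl⟩⟩
      · obtain ⟨y, hy⟩ := hex i hi
        exact ⟨y, fun _ => ⟨hy, fun h => absurd h h0⟩⟩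
    · exact ⟨0, fun h => absurd h hi⟩
  choose y hy using hex'
  obtain ⟨p, hp⟩ := hb.exists_glue y
  refine ⟨p, fun i hi => (hy i hi).1.congr (hp i hi), fun i hi h0 C hC => ?_⟩
  rw [hp i hi C hC]
  exact (hy i hi).2 h0 C hC

/-! ### Steps and runs of the algorithm -/

section Step

variable {s : GDAState E} {p q : E → ℝ}

theorem IsBipartition.proposal_bounds (hb : IsBipartition E U V) (hp : H.IsProposal U s p)
    (C : E) : s.weight C ≤ p C ∧ p C ≤ s.cap C := by
  obtain ⟨i, hi, hC⟩ := hb.exists_left C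
  exact (hp i hi).1.1 C hC

theorem IsBipartition.response_bounds (hb : IsBipartition E U V) (hq : H.IsResponse V p q)
    (C : E) : 0 ≤ q C ∧ q C ≤ p C := by
  obtain ⟨j, hj, hC⟩ := hb.symm.exists_left C
  exact (hq j hj).1.1 C hC

theorem GDAInvariant.isBoxMax_response (hH : H.IsOwnDecomposition f K)
    (hb : IsBipartition E U V) (hs : GDAInvariant H f U V s) (hp : H.IsProposal U s p)
    (hq : H.IsResponse V p q) {j : N} (hj : j ∈ V) :
    IsBoxMax (f j) (H.budget j) (edgesOf E j) 0 p q :=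
  (hH.isOwnArgmax_iff (fun _ _ => le_rfl) fun C _ =>
    (hb.proposal_bounds hp C).2.trans (hs.cap_le C)).1 (hq j hj)

/-- An intact edge was accepted in full, so its endpoint in `U` keeps the swap test of the proposal
while its other edges only fall. A lowered edge was either cut just now, where optimality of the
response applies, or cut earlier and left unchanged, where contentment persists. -/
theorem GDAInvariant.next (hH : H.IsOwnDecomposition f K) (hb : IsBipartition E U V)
    (hs : GDAInvariant H f U V s) (hp : H.IsProposal U s p) (hq : H.IsResponse V p q) :
    GDAInvariant H f U V (gdaNext s p q) := by
  have hpb := hb.proposal_bounds hp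
  have hqb := hb.response_bounds hq
  have hpα (C : E) : p C ≤ H.capacity C := (hpb C).2.trans (hs.cap_le C)
  -- A lowered capacity equals the current weight, so the proposal has no freedom there.
  have hrej {C : E} (h : s.cap C ≠ H.capacity C) : p C = s.weight C :=
    le_antisymm ((hpb C).2.trans_eq (hs.eq_cap C h).symm) (hpb C).1
  have hcap_of_eq {C : E} (h : (gdaNext s p q).cap C = H.capacity C) :
      q C = p C ∧ s.cap C = H.capacity C := by
    by_cases hlt : q C < p C
    · have h' : q C = H.capacity C := by simpa [gdaNext, hlt] using h
      linarith [hpα C]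
    · exact ⟨le_antisymm (hqb C).2 (not_lt.1 hlt), by simpa [gdaNext, hlt] using h⟩
  have hcap_of_ne {C : E} (h : (gdaNext s p q).cap C ≠ H.capacity C) :
      q C < p C ∨ q C = s.weight C ∧ s.cap C ≠ H.capacity C := by
    by_cases hlt : q C < p C
    · exact Or.inl hlt
    · have h' : s.cap C ≠ H.capacity C := by simpa [gdaNext, hlt] using h
      exact Or.inr ⟨(le_antisymm (hqb C).2 (not_lt.1 hlt)).trans (hrej h'), h'⟩
  have hbp {i : N} (hi : i ∈ U) := hs.isBoxMax_proposal hH hp hi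
  have hbq {j : N} (hj : j ∈ V) := hs.isBoxMax_response hH hb hp hq hj
  have hbound (j : N) : ∀ C ∈ edgesOf E j, s.weight C ≤ p C ∧ p C ≤ H.capacity C :=
    fun C _ => ⟨(hpb C).1, hpα C⟩
  constructor
  · exact fun C => (hqb C).1
  · intro C
    by_cases hlt : q C < p C
    · simp [gdaNext, hlt]
    · simpa [gdaNext, hlt] using (hqb C).2.trans (hpb C).2
  · intro C
    by_cases hlt : q C < p C
    · simpa [gdaNext, hlt] using (hqb C).2.trans (hpα C)
    · simpa [gdaNext, hlt] using hs.cap_le C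
  · intro C hC
    by_cases hlt : q C < p C
    · simp [gdaNext, hlt]
    · obtain ⟨h1, h2⟩ := (hcap_of_ne hC).resolve_left hlt
      change q C = if q C < p C then q C else s.cap C
      rw [if_neg hlt, h1, hs.eq_cap C h2]
  · intro i
    rcases hb.mem_or i with hi | hi
    · refine coe_le_of_le ?_ (hp i hi).1.2
      exact Finset.sum_le_sum fun C _ => (hqb C).2
    · exact (hq i hi).1.2
  · intro i C hC
    rcases hb.mem_or i with hi | hi
    · exact ((hbp hi).noGainLower (mem_edgesOf.2 hC) (hs.low i C hC)).mono (hH.concave i C)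
        (hpα C) (hqb C).2
    · exact (hbq hi).noGainLower (mem_edgesOf.2 hC) (noGainLower_zero _)
  · intro i hi C hC hcap D hD hDC
    obtain ⟨h1, h2⟩ := hcap_of_eq hcap
    exact (hs.swapStable_proposal hH hp hi hC hD hDC h2).mono (fun B _ => hH.concave i B)
      (mem_edgesOf.2 hD) h1 (hqb D).2 (hpα D)
  · intro j hj C hC hcap D hD hDC
    rcases hcap_of_ne hcap with hlt | ⟨h1, h2⟩
    · exact (hbq hj).swapStable_of_lt (fun B _ => hH.concave j B) (fun B _ => hpα B)
        (mem_edgesOf.2 hC) (mem_edgesOf.2 hD) hDC hlt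
    · exact (hbq hj).swapStable_of_eq (fun B _ => hH.concave j B) (hbound j)
        (mem_edgesOf.2 hC) (mem_edgesOf.2 hD) hDC
        (fun B hB hBC => hs.swap_right j hj C hC h2 B (mem_edgesOf.1 hB) hBC)
        (hs.raise_right j hj C hC h2) h1
  · intro j hj C hC hcap
    rcases hcap_of_ne hcap with hlt | ⟨h1, h2⟩
    · exact (hbq hj).raiseStable_of_lt (fun B _ => hH.concave j B) (mem_edgesOf.2 hC) hlt
    · exact (hbq hj).raiseStable_of_eq (fun B _ => hH.concave j B) (hbound j)
        (mem_edgesOf.2 hC)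
        (fun B hB hBC => hs.swap_right j hj C hC h2 B (mem_edgesOf.1 hB) hBC)
        (hs.raise_right j hj C hC h2) h1

theorem GDAReachable.gdaInvariant (hH : H.IsOwnDecomposition f K) (hb : IsBipartition E U V)
    (hs : H.GDAReachable U V s) : GDAInvariant H f U V s := by
  induction hs with
  | refl => exact gdaInvariant_init
  | tail _ hstep ih =>
    obtain ⟨p, q, hp, hq, rfl⟩ := hstep
    exact ih.next hH hb hp hq

theorem GDAInvariant.exists_proposal (hH : H.IsOwnDecomposition f K) (hb : IsBipartition E U V)
    (hs : GDAInvariant H f U V s) : ∃ p : E → ℝ, H.IsProposal U s p ∧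
      ∀ i ∈ U, H.PrefersZero i s.weight s.cap p :=
  hb.exists_isOwnArgmax fun i _ =>
    let ⟨y, hy⟩ := exists_isBoxMax (fun C _ => hH.continuous i C) (fun C _ => hs.nonneg C)
      (fun C _ => hs.le_cap C) (fun C _ => hs.cap_le C) (hs.load_le i)
    ⟨y, (hH.isOwnArgmax_iff (fun C _ => hs.nonneg C) fun C _ => hs.cap_le C).2 hy⟩

theorem GDAInvariant.exists_response (hH : H.IsOwnDecomposition f K) (hb : IsBipartition E U V)
    (hs : GDAInvariant H f U V s) (hp : H.IsProposal U s p) : ∃ q : E → ℝ, H.IsResponse V p q ∧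
      ∀ j ∈ V, H.PrefersZero j 0 p q := by
  have hpb := hb.proposal_bounds hp
  have hpα (C : E) : p C ≤ H.capacity C := (hpb C).2.trans (hs.cap_le C)
  refine hb.symm.exists_isOwnArgmax fun j _ => ?_
  obtain ⟨y, hy⟩ := exists_isBoxMax (f := f j) (β := H.budget j) (S := edgesOf E j) (l := 0)
    (h := p) (fun C _ => hH.continuous j C) (fun C _ => le_rfl)
    (fun C _ => (hs.nonneg C).trans (hpb C).1) (fun C _ => hpα C)
    (by simpa using (H.budget_pos j).le)
  exact ⟨y, (hH.isOwnArgmax_iff (fun C _ => le_rfl) fun C _ => hpα C).2 hy⟩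

end Step

section Run

variable {s : ℕ → GDAState E}

theorem GDAInvariant.of_steps (hH : H.IsOwnDecomposition f K) (hb : IsBipartition E U V)
    (h0 : GDAInvariant H f U V (s 0)) (hs : ∀ n, H.GDAStep U V (s n) (s (n + 1))) (n : ℕ) :
    GDAInvariant H f U V (s n) := by
  induction n with
  | zero => exact h0
  | succ n ih =>
    obtain ⟨p, q, hp, hq, h⟩ := hs n
    rw [h]
    exact ih.next hH hb hp hq

/-- The algorithm can run forever. -/
theorem exists_isGDARun (hH : H.IsOwnDecomposition f K) (hb : IsBipartition E U V) :
    ∃ s, H.IsGDARun U V s := by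
  have hstep (s : {s // GDAInvariant H f U V s}) :
      ∃ t : {s // GDAInvariant H f U V s}, H.GDAStep U V s.1 t.1 := by
    obtain ⟨p, hp, -⟩ := s.2.exists_proposal hH hb
    obtain ⟨q, hq, -⟩ := s.2.exists_response hH hb hp
    exact ⟨⟨_, s.2.next hH hb hp hq⟩, p, q, hp, hq, rfl⟩
  choose g hg using hstep
  let r : ℕ → {s // GDAInvariant H f U V s} := fun n => g^[n] ⟨H.gdaInit, gdaInvariant_init⟩
  refine ⟨fun n => (r n).1, rfl, fun n => ?_⟩
  have : r (n + 1) = g (r n) := Function.iterate_succ_apply' g n _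
  simpa only [this] using hg (r n)

/-- Every infinite sequence of steps that starts in a state satisfying the invariant converges to
a fully stable network. -/
theorem GDAInvariant.exists_tendsto (hH : H.IsOwnDecomposition f K) (hb : IsBipartition E U V)
    (h0 : GDAInvariant H f U V (s 0)) (hs : ∀ n, H.GDAStep U V (s n) (s (n + 1))) :
    ∃ x : E → ℝ, Tendsto (fun n => (s n).weight) atTop (𝓝 x) ∧ H.FullyStable x := by
  have hinv := h0.of_steps hH hb hs
  choose p q hp hq hnext using hs
  have hpb (n : ℕ) := hb.proposal_bounds (hp n)
  have hqb (n : ℕ) := hb.response_bounds (hq n)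
  have hw (n : ℕ) (C : E) : (s (n + 1)).weight C = q n C := by rw [hnext n]; rfl
  have hrej {n : ℕ} {C : E} (h : (s n).cap C ≠ H.capacity C) : p n C = (s n).weight C :=
    le_antisymm ((hpb n C).2.trans_eq ((hinv n).eq_cap C h).symm) (hpb n C).1
  have hcap_le (n : ℕ) (C : E) : (s (n + 1)).cap C ≤ (s n).cap C := by
    rw [hnext n]
    by_cases hlt : q n C < p n C
    · simpa [gdaNext, hlt] using (hqb n C).2.trans (hpb n C).2
    · simp [gdaNext, hlt]
  have hcap_eq {n : ℕ} {C : E} (h : (s (n + 1)).cap C = H.capacity C) : q n C = p n C := by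
    by_contra hne
    have hlt := lt_of_le_of_ne (hqb n C).2 hne
    have h' : q n C = H.capacity C := by simpa [hnext n, gdaNext, hlt] using h
    linarith [(hpb n C).2, (hinv n).cap_le C]
  have hanti (C : E) : Antitone fun n => (s n).cap C := antitone_nat_of_succ_le fun n => hcap_le n C
  have hpersist {C : E} {m n : ℕ} (hmn : m ≤ n) (h : (s m).cap C ≠ H.capacity C) :
      (s n).cap C ≠ H.capacity C :=
    ((hanti C hmn).trans_lt (lt_of_le_of_ne ((hinv m).cap_le C) h)).ne
  have hmem (n : ℕ) (C : E) : (s n).weight C ∈ Set.Icc 0 (H.capacity C) :=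
    ⟨(hinv n).nonneg C, ((hinv n).le_cap C).trans ((hinv n).cap_le C)⟩
  have hpmem (n : ℕ) (C : E) : p n C ∈ Set.Icc 0 (H.capacity C) :=
    ⟨((hinv n).nonneg C).trans (hpb n C).1, (hpb n C).2.trans ((hinv n).cap_le C)⟩
  -- Once its capacity is lowered, an edge is proposed at its current weight and can only be cut. If
  -- the capacity is never lowered, every proposal is accepted in full and the proposals are the
  -- weights shifted by one step.
  have hlim (C : E) : ∃ c, Tendsto (fun n => (s n).weight C) atTop (𝓝 c) ∧
      Tendsto (fun n => p n C) atTop (𝓝 c) := by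
    by_cases hC : ∃ m, (s m).cap C ≠ H.capacity C
    · obtain ⟨m, hm⟩ := hC
      have hmono : Antitone fun n => (s (n + m)).weight C := antitone_nat_of_succ_le fun n => by
        rw [add_right_comm, hw, ← hrej (hpersist (Nat.le_add_left m n) hm)]
        exact (hqb _ C).2
      have hconv := tendsto_atTop_ciInf hmono ⟨0, by rintro _ ⟨n, rfl⟩; exact (hmem _ C).1⟩
      have hconv' := (tendsto_add_atTop_iff_nat (f := fun n => (s n).weight C) m).1 hconv
      refine ⟨_, hconv', hconv'.congr' ?_⟩
      filter_upwards [eventually_ge_atTop m] with n hn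
      exact (hrej (hpersist hn hm)).symm
    · push Not at hC
      have hstep (n : ℕ) : (s (n + 1)).weight C = p n C := (hw n C).trans (hcap_eq (hC (n + 1)))
      have hmono : Monotone fun n => (s n).weight C := monotone_nat_of_le_succ fun n => by
        rw [hstep]
        exact (hpb n C).1
      have hconv := tendsto_atTop_ciSup hmono
        ⟨H.capacity C, by rintro _ ⟨n, rfl⟩; exact (hmem _ C).2⟩
      refine ⟨_, hconv, ?_⟩
      simpa [hstep] using (tendsto_add_atTop_iff_nat (f := fun n => (s n).weight C) 1).2 hconv
  choose x hxs hxp using hlim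
  have hxs' : Tendsto (fun n => (s n).weight) atTop (𝓝 x) := tendsto_pi_nhds.2 hxs
  have hxp' : Tendsto p atTop (𝓝 x) := tendsto_pi_nhds.2 hxp
  refine ⟨x, hxs', hH.fullyStable ⟨fun C => ?_, fun i => ?_⟩ (fun i C hC => ?_) fun C => ?_⟩
  · exact isClosed_Icc.mem_of_tendsto (hxs C) (Eventually.of_forall fun n => hmem n C)
  · have hl : Tendsto (fun n => (load (s n).weight i : EReal)) atTop (𝓝 (load x i : EReal)) :=
      (continuous_coe_real_ereal.tendsto _).comp (tendsto_finsetSum _ fun C _ => hxs C)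
    exact le_of_tendsto' hl fun n => (hinv n).load_le i
  · exact noGainLower_of_tendsto (hH.continuous i C) (fun n => hmem n C)
      (fun n => (hinv n).low i C hC) (hxs C)
  · by_cases hC : ∃ m, (s m).cap C ≠ H.capacity C
    · obtain ⟨m, hm⟩ := hC
      obtain ⟨j, hj, hjC⟩ := hb.symm.exists_left C
      refine ⟨j, hjC, fun D hD hDC => ?_, ?_⟩
      · refine swapStable_of_tendsto (S := edgesOf E j) (fun B _ => hH.continuous j B)
          (fun n B _ => hmem n B) (mem_edgesOf.2 hjC) (mem_edgesOf.2 hD) hxs' ?_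
        filter_upwards [eventually_ge_atTop m] with n hn
        exact (hinv n).swap_right j hj C hjC (hpersist hn hm) D hD hDC
      · refine raiseStable_of_tendsto (fun B _ => hH.continuous j B) (fun B _ => hH.concave j B)
          (fun n B _ => hmem n B) (mem_edgesOf.2 hjC) hxs' ?_
        filter_upwards [eventually_ge_atTop m] with n hn
        exact (hinv n).raise_right j hj C hjC (hpersist hn hm)
    · push Not at hC
      obtain ⟨i, hi, hiC⟩ := hb.exists_left C
      refine ⟨i, hiC, fun D hD hDC => ?_, ?_⟩
      -- The limit is taken along the proposals, where the raise test for `U` also holds.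
      · exact swapStable_of_tendsto (S := edgesOf E i) (fun B _ => hH.continuous i B)
          (fun n B _ => hpmem n B) (mem_edgesOf.2 hiC) (mem_edgesOf.2 hD) hxp'
          (Eventually.of_forall fun n =>
            (hinv n).swapStable_proposal hH (hp n) hi hiC hD hDC (hC n))
      · exact raiseStable_of_tendsto (fun B _ => hH.continuous i B) (fun B _ => hH.concave i B)
          (fun n B _ => hpmem n B) (mem_edgesOf.2 hiC) hxp'
          (Eventually.of_forall fun n => (hinv n).raiseStable_proposal hH (hp n) hi hiC (hC n))

theorem IsGDARun.exists_tendsto (hH : H.IsOwnDecomposition f K) (hb : IsBipartition E U V)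
    (hs : H.IsGDARun U V s) :
    ∃ x : E → ℝ, Tendsto (fun n => (s n).weight) atTop (𝓝 x) ∧ H.FullyStable x :=
  GDAInvariant.exists_tendsto hH hb (by rw [hs.1]; exact gdaInvariant_init) hs.2

end Run

/-- Initially the box is the single point `0`; later the weights maximize over the larger box below
the last proposal. With the termination test this makes a terminal state a fixed point. -/
theorem GDAReachable.isResponse_self (hH : H.IsOwnDecomposition f K) (hb : IsBipartition E U V)
    {s : GDAState E} (hs : H.GDAReachable U V s) : H.IsResponse V s.weight s.weight := by
  rcases Relation.ReflTransGen.cases_tail hs with rfl | ⟨t, ht, p, q, hp, hq, rfl⟩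
  · intro j hj
    obtain ⟨y, hy⟩ := exists_isBoxMax (f := f j) (β := H.budget j) (S := edgesOf E j) (l := 0)
      (h := 0) (fun C _ => hH.continuous j C) (fun C _ => le_rfl) (fun C _ => le_rfl)
      (fun C _ => (H.capacity_mem C).1) (by simpa using (H.budget_pos j).le)
    have hy' := (hH.isOwnArgmax_iff (fun _ _ => le_rfl) fun C _ => (H.capacity_mem C).1).2 hy
    exact hy'.congr fun C hC => le_antisymm (hy'.1.1 C hC).1 (hy'.1.1 C hC).2
  · have hqb := hb.response_bounds hq
    intro j hj
    exact ⟨⟨fun C _ => ⟨(hqb C).1, le_rfl⟩, (hq j hj).1.2⟩, fun w hw => (hq j hj).2 w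
      ⟨fun C hC => ⟨(hw.1 C hC).1, (hw.1 C hC).2.trans (hqb C).2⟩, hw.2⟩⟩

/-- The network returned by the algorithm is fully stable. -/
theorem GDAReachable.fullyStable_of_terminal (hH : H.IsOwnDecomposition f K)
    (hb : IsBipartition E U V) {s : GDAState E} (hs : H.GDAReachable U V s)
    (ht : H.GDATerminal U s) : H.FullyStable s.weight := by
  have hstep : H.GDAStep U V s s :=
    ⟨s.weight, s.weight, ht, hs.isResponse_self hH hb, by simp [gdaNext]⟩
  obtain ⟨x, hx, hstable⟩ := GDAInvariant.exists_tendsto (s := fun _ => s) hH hb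
    (hs.gdaInvariant hH hb) fun _ => hstep
  rwa [tendsto_nhds_unique hx tendsto_const_nhds] at hstable

end NetworkGame

theorem mainTheorem7 {N : Type*} [Fintype N] [DecidableEq N] {E : Finset (Finset N)}
    (G : NetworkGame N E)
    (hcont : G.IsContinuous) (hsep : G.IsSeparable) (hconc : G.IsConcave)
    (hpos : G.HasPositiveExternalities)
    (hbip : ∃ U V : Finset N, NetworkGame.IsBipartition E U V) :
    (∃ x : E → ℝ, G.FullyStable x) ∧
    ∀ U V : Finset N, NetworkGame.IsBipartition E U V → ∀ z ∈ G.capacityBox,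
      -- full stability for the frozen game is inherited by the original game
      (∀ x : E → ℝ, (G.freeze z).FullyStable x → G.FullyStable x) ∧
      -- the algorithm never gets stuck, also when ties are broken in favour of zero
      (∀ s, (G.freeze z).GDAReachable U V s →
        (∃ p : E → ℝ, (G.freeze z).IsProposal U s p ∧
          ∀ i ∈ U, (G.freeze z).PrefersZero i s.weight s.cap p) ∧
        (∀ p : E → ℝ, (G.freeze z).IsProposal U s p →
          ∃ q : E → ℝ, (G.freeze z).IsResponse V p q ∧
            ∀ j ∈ V, (G.freeze z).PrefersZero j 0 p q)) ∧
      -- if it terminates, then the network it returns is fully stable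
      (∀ s, (G.freeze z).GDAReachable U V s → (G.freeze z).GDATerminal U s →
        (G.freeze z).FullyStable s.weight ∧ G.FullyStable s.weight) ∧
      -- if it runs forever, then its networks converge to a fully stable network
      (∀ s : ℕ → NetworkGame.GDAState E, (G.freeze z).IsGDARun U V s →
        ∃ x : E → ℝ, Tendsto (fun n => (s n).weight) atTop (𝓝 x) ∧
          (G.freeze z).FullyStable x ∧ G.FullyStable x) := by
  obtain ⟨g, hg⟩ := hsep
  have hH {z : E → ℝ} (hz : z ∈ G.capacityBox) :=
    NetworkGame.isOwnDecomposition_freeze hg hcont hconc hz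
  have hinherit {z : E → ℝ} (hz : z ∈ G.capacityBox) {x : E → ℝ}
      (hx : (G.freeze z).FullyStable x) : G.FullyStable x := hx.of_freeze hg hpos hz
  refine ⟨?_, fun U V hb z hz => ⟨fun x => hinherit hz, fun s hs => ?_, fun s hs ht => ?_,
    fun s hs => ?_⟩⟩
  · obtain ⟨U, V, hb⟩ := hbip
    -- For existence any freezing point will do; zero is always within the capacities.
    have hz : (0 : E → ℝ) ∈ G.capacityBox := fun C => ⟨le_rfl, (G.capacity_mem C).1⟩
    obtain ⟨s, hs⟩ := NetworkGame.exists_isGDARun (hH hz) hb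
    obtain ⟨x, -, hx⟩ := hs.exists_tendsto (hH hz) hb
    exact ⟨x, hinherit hz hx⟩
  · have hinv := hs.gdaInvariant (hH hz) hb
    exact ⟨hinv.exists_proposal (hH hz) hb, fun p hp => hinv.exists_response (hH hz) hb hp⟩
  · have hx := hs.fullyStable_of_terminal (hH hz) hb ht
    exact ⟨hx, hinherit hz hx⟩
  · obtain ⟨x, hlim, hx⟩ := hs.exists_tendsto (hH hz) hb
    exact ⟨x, hlim, hx, hinherit hz hx⟩
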